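/- For each $n$ let $p=p(n)\in[0,1]$ and let $G(n,p)$ be the Erdős–Rényi random graph on $n$ nodes, in which each possible edge between two distinct nodes is present independently with probability $p$. Suppose that $\limsup_{n\to\infty}\frac{\ln n}{np}<1$ (where $\frac{\ln n}{np}=\infty$ if $p=0$ and $n\ge 2$). Let $k=k(n)$ be positive integers with $k=o(\sqrt{np})$ and, independently of the graph, let $S$ be chosen uniformly at random among the sets of nodes with $|S|=k$. Let $\lambda$ be the smallest eigenvalue of the grounded Laplacian $L_g(S)$, that is, of the matrix obtained from the graph Laplacian $L=D-A$ ($A$ the adjacency matrix, $D$ the diagonal matrix of degrees) by deleting the rows and columns indexed by $S$. Then $$(1-o(1))\,|S|\,p\;\le\;\lambda\;\le\;(1+o(1))\,|S|\,p$$ asymptotically almost surely; that is, there is a deterministic function $h(n)\to 0$ such that, over the random choice of the graph and of $S$, $\Pr\big[(1-h(n))|S|p\le\lambda\le(1+h(n))|S|p\big]\to 1$ as $n\to\infty$. -/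

import Mathlib

open Filter Topology MeasureTheory ProbabilityTheory

noncomputable section

open Classical in
/-- The grounded Laplacian `L_g(S)`: the Laplacian matrix `L = D - A` of `G` with the rows and
columns of the grounded nodes `S` removed. -/
def groundedLaplacian {V : Type*} [Fintype V] [DecidableEq V] (G : SimpleGraph V)
    (S : Finset V) : Matrix {v // v ∉ S} {v // v ∉ S} ℝ :=
  (G.lapMatrix ℝ).submatrix Subtype.val Subtype.val

/-- The smallest eigenvalue `λ(L_g(S))` of the grounded Laplacian. It is a genuine minimum as soon
as some node is not grounded, see `isLeast_groundedEigenvalue`. -/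
def groundedEigenvalue {V : Type*} [Fintype V] [DecidableEq V] (G : SimpleGraph V)
    (S : Finset V) : ℝ :=
  sInf {μ : ℝ | Module.End.HasEigenvalue (Matrix.toLin' (groundedLaplacian G S)) μ}

theorem isHermitian_groundedLaplacian {V : Type*} [Fintype V] [DecidableEq V]
    (G : SimpleGraph V) (S : Finset V) : (groundedLaplacian G S).IsHermitian := by
  classical
  exact (G.isHermitian_lapMatrix ℝ).submatrix _

theorem isLeast_groundedEigenvalue {V : Type*} [Fintype V] [DecidableEq V]
    (G : SimpleGraph V) (S : Finset V) (hS : ∃ v, v ∉ S) :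
    IsLeast {μ : ℝ | Module.End.HasEigenvalue (Matrix.toLin' (groundedLaplacian G S)) μ}
      (groundedEigenvalue G S) := by
  have hset : {μ : ℝ | Module.End.HasEigenvalue (Matrix.toLin' (groundedLaplacian G S)) μ} =
      Set.range (isHermitian_groundedLaplacian G S).eigenvalues := by
    rw [← Matrix.IsHermitian.spectrum_real_eq_range_eigenvalues]
    ext μ
    rw [Set.mem_ofPred_eq, Module.End.hasEigenvalue_iff_mem_spectrum, Matrix.spectrum_toLin']
  have hne : Nonempty {v // v ∉ S} := let ⟨v, hv⟩ := hS; ⟨⟨v, hv⟩⟩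
  have hfin : {μ : ℝ | Module.End.HasEigenvalue
      (Matrix.toLin' (groundedLaplacian G S)) μ}.Finite := by
    rw [hset]; exact Set.finite_range _
  have hn : {μ : ℝ | Module.End.HasEigenvalue
      (Matrix.toLin' (groundedLaplacian G S)) μ}.Nonempty := by
    rw [hset]; exact Set.range_nonempty _
  exact ⟨hn.csInf_mem hfin, fun μ hμ => csInf_le hfin.bddBelow hμ⟩

/-- The joint law of an Erdős–Rényi random graph `G(n, p)` on the nodes `Fin n` (every edge present
independently with probability `p`) and, independently of it, a grounded set chosen uniformly at
random among the `k`-element sets of nodes. -/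
def groundedErdosRenyi (n : ℕ) (p : unitInterval) (k : ℕ) :
    Measure (SimpleGraph (Fin n) × Finset (Fin n)) :=
  (SimpleGraph.binomialRandom (Fin n) p).prod (uniformOn {S : Finset (Fin n) | S.card = k})

end

/-!
For a fixed grounded set `S`, testing the quadratic form of `L_g(S)` with the all-ones vector gives
`λ ≤ e(S, Sᶜ) / |Sᶜ|`. Conversely, write a vector as `y + a` with `a` its mean. If
the graph on `Sᶜ` expands at rate `β` and has degrees at most `D`, the discrete Cheeger inequality
bounds the Dirichlet energy below by `m ∑ yᵢ²` with `m = β² / (8 D)`, and completing the square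
against the potential `e(u, S)` loses only a factor `1 - 2 |S| / m`. In `G(n, p)` all of this holds
with exponentially small failure probability by Chernoff and union bounds: `e(S, Sᶜ)` is close to
`|S| |Sᶜ| p`, the degrees are at most `4 n p`, and, because `ln n ≤ (1 - τ) n p`, the expansion rate
is of order `n p`. The bounds do not depend on which `S` of the given size is chosen, so they
survive averaging over `S`.
-/

noncomputable section

open scoped Finset

theorem posPart_mul_negPart_eq_zero {α : Type*} [Ring α] [LinearOrder α] [IsOrderedRing α]
    (a : α) : a⁺ * a⁻ = 0 := by
  rcases le_total 0 a with ha | ha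
  · rw [negPart_of_nonneg ha, mul_zero]
  · rw [posPart_of_nonpos ha, zero_mul]

section Cheeger

variable {ι : Type*} [Fintype ι]

/-- The Dirichlet energy of `f` on the graph with edge weights `w`; the factor `1 / 2` is there
because every unordered pair of nodes is summed twice. -/
def dirichletEnergy (w : ι → ι → ℝ) (f : ι → ℝ) : ℝ :=
  (∑ u, ∑ v, w u v * (f u - f v) ^ 2) / 2

/-- Edge expansion at rate `β`: each set `A` of at most half of the nodes is joined to its
complement by edges of total weight at least `β * #A`, that is, the isoperimetric (Cheeger) constant
of the weighted graph is at least `β`. -/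
def IsEdgeExpanding [DecidableEq ι] (w : ι → ι → ℝ) (β : ℝ) : Prop :=
  ∀ A : Finset ι, 2 * #A ≤ Fintype.card ι → β * #A ≤ ∑ u ∈ A, ∑ v ∈ Aᶜ, w u v

variable {w : ι → ι → ℝ} {β : ℝ}

theorem dirichletEnergy_nonneg (hw : ∀ u v, 0 ≤ w u v) (f : ι → ℝ) : 0 ≤ dirichletEnergy w f :=
  div_nonneg (Finset.sum_nonneg fun u _ => Finset.sum_nonneg fun v _ =>
    mul_nonneg (hw u v) (sq_nonneg _)) zero_le_two

theorem dirichletEnergy_add_const (w : ι → ι → ℝ) (f : ι → ℝ) (a : ℝ) :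
    dirichletEnergy w (fun i => f i + a) = dirichletEnergy w f := by
  simp only [dirichletEnergy, add_sub_add_right_eq_sub]

theorem dirichletEnergy_posPart_add_negPart_le (hw : ∀ u v, 0 ≤ w u v) (f : ι → ℝ) :
    dirichletEnergy w (fun i => (f i)⁺) + dirichletEnergy w (fun i => (f i)⁻) ≤
      dirichletEnergy w f := by
  have hpair (a b : ℝ) : (a⁺ - b⁺) ^ 2 + (a⁻ - b⁻) ^ 2 ≤ (a - b) ^ 2 := by
    have hcross : 0 ≤ a⁺ * b⁻ + a⁻ * b⁺ := by positivity
    calc (a⁺ - b⁺) ^ 2 + (a⁻ - b⁻) ^ 2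
        ≤ ((a⁺ - a⁻) - (b⁺ - b⁻)) ^ 2 := by
          nlinarith [posPart_mul_negPart_eq_zero a, posPart_mul_negPart_eq_zero b]
      _ = (a - b) ^ 2 := by rw [posPart_sub_negPart, posPart_sub_negPart]
  rw [dirichletEnergy, dirichletEnergy, dirichletEnergy, ← add_div]
  simp only [← Finset.sum_add_distrib, ← mul_add]
  gcongr with u _ v _
  · exact hw u v
  · exact hpair _ _

/-- Co-area formula: apply the expansion hypothesis to each superlevel set `{i | t < f i}` and
integrate over the height `t`. -/
theorem IsEdgeExpanding.mul_sum_le [DecidableEq ι] (hexp : IsEdgeExpanding w β)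
    {f : ι → ℝ} (hf : ∀ i, 0 ≤ f i) (hsupp : 2 * #{i | 0 < f i} ≤ Fintype.card ι) :
    β * ∑ i, f i ≤ ∑ u, ∑ v, w u v * max (f u - f v) 0 := by
  have hvol (a b : ℝ) : max (b - a) 0 = ∫ t, (Set.Ico a b).indicator 1 t := by
    rw [integral_indicator_one measurableSet_Ico, Real.volume_real_Ico]
  have hint (a b : ℝ) : Integrable ((Set.Ico a b).indicator (1 : ℝ → ℝ)) :=
    (integrable_indicator_iff measurableSet_Ico).2 (integrableOn_const (by simp))
  have hlevel (t : ℝ) : β * ∑ i, (Set.Ico 0 (f i)).indicator (1 : ℝ → ℝ) t ≤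
      ∑ u, ∑ v, w u v * (Set.Ico (f v) (f u)).indicator 1 t := by
    rcases lt_or_ge t 0 with ht | ht
    · have hzero (a b : ℝ) (ha : 0 ≤ a) : (Set.Ico a b).indicator (1 : ℝ → ℝ) t = 0 :=
        Set.indicator_of_notMem (fun h => (ht.trans_le ha).not_ge h.1) _
      simp only [hzero _ _ le_rfl, hzero _ _ (hf _), mul_zero, Finset.sum_const_zero, le_refl]
    · have hcard : #{i | t < f i} ≤ #{i | 0 < f i} :=
        Finset.card_le_card (Finset.monotone_filter_right _ fun i _ hi => ht.trans_lt hi)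
      refine (le_of_eq ?_).trans ((hexp {i | t < f i} (by lia)).trans (le_of_eq ?_))
      · simp [Set.indicator_apply, ht, Finset.sum_boole]
      · rw [Finset.sum_filter]
        refine Finset.sum_congr rfl fun u _ => ?_
        by_cases hu : t < f u
        · simp [Set.indicator_apply, Finset.compl_filter, Finset.sum_filter, hu]
        · simp [hu]
  calc β * ∑ i, f i = ∫ t, β * ∑ i, (Set.Ico 0 (f i)).indicator (1 : ℝ → ℝ) t := by
        rw [integral_const_mul, integral_finsetSum _ fun i _ => hint 0 (f i)]
        simp only [← hvol, sub_zero, max_eq_left (hf _)]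
    _ ≤ ∫ t, ∑ u, ∑ v, w u v * (Set.Ico (f v) (f u)).indicator 1 t :=
        integral_mono ((integrable_finsetSum _ fun i _ => hint 0 (f i)).const_mul β)
          (integrable_finsetSum _ fun u _ => integrable_finsetSum _ fun v _ =>
            (hint (f v) (f u)).const_mul _) hlevel
    _ = ∑ u, ∑ v, w u v * max (f u - f v) 0 := by
        rw [integral_finsetSum _ fun u _ => integrable_finsetSum _ fun v _ =>
          (hint (f v) (f u)).const_mul _]
        refine Finset.sum_congr rfl fun u _ => ?_
        rw [integral_finsetSum _ fun v _ => (hint (f v) (f u)).const_mul _]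
        simp only [integral_const_mul, hvol]

theorem sum_sum_mul_add_sq_le (hw : ∀ u v, 0 ≤ w u v) (hsymm : ∀ u v, w u v = w v u) {D : ℝ}
    (hdeg : ∀ u, ∑ v, w u v ≤ D) (f : ι → ℝ) :
    ∑ u, ∑ v, w u v * (f u + f v) ^ 2 ≤ 4 * D * ∑ i, f i ^ 2 := by
  have hfst : ∑ u, ∑ v, w u v * f u ^ 2 ≤ D * ∑ i, f i ^ 2 := by
    simp only [Finset.mul_sum, ← Finset.sum_mul]
    gcongr
    exact hdeg _
  have hsnd : ∑ u, ∑ v, w u v * f v ^ 2 = ∑ u, ∑ v, w u v * f u ^ 2 := by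
    rw [Finset.sum_comm]
    simp only [hsymm]
  calc ∑ u, ∑ v, w u v * (f u + f v) ^ 2
      ≤ ∑ u, ∑ v, w u v * (2 * (f u ^ 2 + f v ^ 2)) := by
        gcongr with u _ v _
        · exact hw u v
        · exact add_sq_le
    _ = 2 * (∑ u, ∑ v, w u v * f u ^ 2 + ∑ u, ∑ v, w u v * f v ^ 2) := by
        simp only [← Finset.sum_add_distrib, Finset.mul_sum]
        congr! 2
        ring
    _ ≤ 4 * D * ∑ i, f i ^ 2 := by linarith

theorem sq_sum_mul_posPart_sq_sub_sq_le (hw : ∀ u v, 0 ≤ w u v) (f : ι → ℝ) :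
    (∑ u, ∑ v, w u v * max (f u ^ 2 - f v ^ 2) 0) ^ 2 ≤
      2 * dirichletEnergy w f * ∑ u, ∑ v, w u v * (f u + f v) ^ 2 := by
  rw [dirichletEnergy, mul_div_cancel₀ _ two_ne_zero]
  simp only [← Fintype.sum_prod_type']
  refine Finset.sum_sq_le_sum_mul_sum_of_sq_le_mul _
    (fun x _ => mul_nonneg (hw _ _) (sq_nonneg _)) (fun x _ => mul_nonneg (hw _ _) (sq_nonneg _))
    fun x _ => ?_
  have hmax : max (f x.1 ^ 2 - f x.2 ^ 2) 0 ^ 2 ≤ (f x.1 ^ 2 - f x.2 ^ 2) ^ 2 := by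
    rw [← sq_abs (f x.1 ^ 2 - f x.2 ^ 2)]
    gcongr
    exact max_le (le_abs_self _) (abs_nonneg _)
  calc (w x.1 x.2 * max (f x.1 ^ 2 - f x.2 ^ 2) 0) ^ 2
      ≤ w x.1 x.2 ^ 2 * (f x.1 ^ 2 - f x.2 ^ 2) ^ 2 := by
        rw [mul_pow]
        gcongr
    _ = w x.1 x.2 * (f x.1 - f x.2) ^ 2 * (w x.1 x.2 * (f x.1 + f x.2) ^ 2) := by ring

theorem exists_median [Nonempty ι] (y : ι → ℝ) :
    ∃ m : ℝ, 2 * #{i | m < y i} ≤ Fintype.card ι ∧ 2 * #{i | y i < m} ≤ Fintype.card ι := by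
  classical
  set upper : Finset ι := {j | 2 * #{i | y j < y i} ≤ Fintype.card ι}
  have hupper : upper.Nonempty := by
    obtain ⟨M, -, hM⟩ := (Finset.univ : Finset ι).exists_max_image y Finset.univ_nonempty
    refine ⟨M, Finset.mem_filter.2 ⟨Finset.mem_univ M, ?_⟩⟩
    rw [Finset.filter_false_of_mem fun i hi => not_lt.2 (hM i hi)]
    simp
  obtain ⟨a, ha, hmin⟩ := upper.exists_min_image y hupper
  refine ⟨y a, (Finset.mem_filter.1 ha).2, ?_⟩
  by_contra! hlarge
  set below : Finset ι := {i | y i < y a}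
  obtain ⟨b, hb, hmax⟩ := below.exists_max_image y (Finset.card_pos.1 (by lia))
  have habove : ({i | y b < y i} : Finset ι) ⊆ belowᶜ := fun i hi =>
    Finset.mem_compl.2 fun hib => (hmax i hib).not_gt (Finset.mem_filter.1 hi).2
  have hcard := Finset.card_le_card habove
  rw [Finset.card_compl] at hcard
  have hb' : b ∈ upper := Finset.mem_filter.2 ⟨Finset.mem_univ b, by lia⟩
  exact (hmin b hb').not_gt (Finset.mem_filter.1 hb).2

variable [DecidableEq ι]

theorem IsEdgeExpanding.mul_sum_sq_le_of_nonneg (hexp : IsEdgeExpanding w β)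
    (hw : ∀ u v, 0 ≤ w u v) (hsymm : ∀ u v, w u v = w v u) {D : ℝ} (hβ : 0 ≤ β) (hD : 0 < D)
    (hdeg : ∀ u, ∑ v, w u v ≤ D) {f : ι → ℝ} (hf : ∀ i, 0 ≤ f i)
    (hsupp : 2 * #{i | 0 < f i} ≤ Fintype.card ι) :
    β ^ 2 / (8 * D) * ∑ i, f i ^ 2 ≤ dirichletEnergy w f := by
  set F := ∑ i, f i ^ 2
  have hF : 0 ≤ F := Finset.sum_nonneg fun i _ => sq_nonneg _
  have hE := dirichletEnergy_nonneg hw f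
  have hcoarea : β * F ≤ ∑ u, ∑ v, w u v * max (f u ^ 2 - f v ^ 2) 0 := by
    refine hexp.mul_sum_le (fun i => sq_nonneg _) ?_
    simpa only [sq_pos_iff, (hf _).lt_iff_ne'] using hsupp
  have hsq : F * (β ^ 2 * F) ≤ F * (dirichletEnergy w f * (8 * D)) := calc
    F * (β ^ 2 * F) = (β * F) ^ 2 := by ring
    _ ≤ (∑ u, ∑ v, w u v * max (f u ^ 2 - f v ^ 2) 0) ^ 2 := by gcongr
    _ ≤ 2 * dirichletEnergy w f * ∑ u, ∑ v, w u v * (f u + f v) ^ 2 :=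
        sq_sum_mul_posPart_sq_sub_sq_le hw f
    _ ≤ 2 * dirichletEnergy w f * (4 * D * F) := by
        gcongr
        exact sum_sum_mul_add_sq_le hw hsymm hdeg f
    _ = F * (dirichletEnergy w f * (8 * D)) := by ring
  rcases hF.eq_or_lt with hF0 | hF0
  · rwa [← hF0, mul_zero]
  · rw [div_mul_eq_mul_div, div_le_iff₀ (by positivity)]
    exact le_of_mul_le_mul_left hsq hF0

theorem IsEdgeExpanding.cheeger (hexp : IsEdgeExpanding w β) (hw : ∀ u v, 0 ≤ w u v)
    (hsymm : ∀ u v, w u v = w v u) {D : ℝ} (hβ : 0 ≤ β) (hD : 0 < D) (hdeg : ∀ u, ∑ v, w u v ≤ D)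
    {y : ι → ℝ} (hy : ∑ i, y i = 0) :
    β ^ 2 / (8 * D) * ∑ i, y i ^ 2 ≤ dirichletEnergy w y := by
  cases isEmpty_or_nonempty ι
  · simp [dirichletEnergy]
  obtain ⟨m, hm_lt, hlt_m⟩ := exists_median y
  set z : ι → ℝ := fun i => y i + -m
  have hpos : β ^ 2 / (8 * D) * ∑ i, (z i)⁺ ^ 2 ≤ dirichletEnergy w (fun i => (z i)⁺) :=
    hexp.mul_sum_sq_le_of_nonneg hw hsymm hβ hD hdeg (fun i => posPart_nonneg _) (by
      simpa only [posPart_pos_iff, z, lt_add_neg_iff_add_lt, zero_add] using hm_lt)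
  have hneg : β ^ 2 / (8 * D) * ∑ i, (z i)⁻ ^ 2 ≤ dirichletEnergy w (fun i => (z i)⁻) :=
    hexp.mul_sum_sq_le_of_nonneg hw hsymm hβ hD hdeg (fun i => negPart_nonneg _) (by
      simpa only [negPart_pos_iff, z, add_neg_lt_iff_lt_add, zero_add] using hlt_m)
  have hmean : ∑ i, y i ^ 2 ≤ ∑ i, z i ^ 2 := by
    have : ∑ i, z i ^ 2 = ∑ i, y i ^ 2 + Fintype.card ι * m ^ 2 := by
      simp only [z, add_sq, Finset.sum_add_distrib, ← Finset.mul_sum, ← Finset.sum_mul, hy]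
      simp
    rw [this]
    exact le_add_of_nonneg_right (by positivity)
  have hsplit (i : ι) : z i ^ 2 = (z i)⁺ ^ 2 + (z i)⁻ ^ 2 := by
    conv_lhs => rw [← posPart_sub_negPart (z i)]
    linear_combination -2 * posPart_mul_negPart_eq_zero (z i)
  calc β ^ 2 / (8 * D) * ∑ i, y i ^ 2
      ≤ β ^ 2 / (8 * D) * (∑ i, (z i)⁺ ^ 2 + ∑ i, (z i)⁻ ^ 2) := by
        rw [← Finset.sum_add_distrib]
        simp only [← hsplit]
        gcongr
    _ ≤ dirichletEnergy w z := by
        rw [mul_add]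
        exact (add_le_add hpos hneg).trans (dirichletEnergy_posPart_add_negPart_le hw z)
    _ = dirichletEnergy w y := dirichletEnergy_add_const w y (-m)

end Cheeger

section Potential

variable {ι : Type*} [Fintype ι] {w : ι → ι → ℝ}

theorem dirichletEnergy_eq_sum_mul_sum (hsymm : ∀ u v, w u v = w v u) (f : ι → ℝ) :
    dirichletEnergy w f = ∑ u, f u * ∑ v, w u v * (f u - f v) := by
  have hswap : ∑ u, ∑ v, w u v * (f v * (f v - f u)) = ∑ u, ∑ v, w u v * (f u * (f u - f v)) := by
    rw [Finset.sum_comm]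
    simp only [hsymm]
  have hsq : ∑ u, ∑ v, w u v * (f u - f v) ^ 2 =
      ∑ u, ∑ v, w u v * (f u * (f u - f v)) + ∑ u, ∑ v, w u v * (f v * (f v - f u)) := by
    simp only [← Finset.sum_add_distrib]
    congr! 2
    ring
  rw [dirichletEnergy, hsq, hswap, ← two_mul, mul_div_cancel_left₀ _ two_ne_zero]
  simp only [Finset.mul_sum, mul_left_comm]

theorem sum_sq_eq_card_mul_sq_add (x : ι → ℝ) {y : ι → ℝ} {a : ℝ} (hxy : ∀ i, x i = y i + a)
    (hy : ∑ i, y i = 0) : ∑ i, x i ^ 2 = Fintype.card ι * a ^ 2 + ∑ i, y i ^ 2 := by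
  simp only [hxy, add_sq, Finset.sum_add_distrib, ← Finset.mul_sum, ← Finset.sum_mul, hy]
  simp [add_comm]

/-- With `x = a + y`, `a` the mean of `x`, the spectral gap spends half of `m * ∑ y ^ 2` on the
centred part and the other half on absorbing, by completing a square, the cross terms
`2 * a * d i * y i` of the potential. -/
theorem mul_sum_sq_le_dirichletEnergy_add {d : ι → ℝ} {m K κ : ℝ} (hm : 0 < m)
    (hgap : ∀ y : ι → ℝ, ∑ i, y i = 0 → m * ∑ i, y i ^ 2 ≤ dirichletEnergy w y)
    (hd : ∀ i, 0 ≤ d i) (hdK : ∀ i, d i ≤ K) (hκm : κ ≤ m / 2)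
    (hκd : κ * Fintype.card ι ≤ (1 - 2 * K / m) * ∑ i, d i) (x : ι → ℝ) :
    κ * ∑ i, x i ^ 2 ≤ dirichletEnergy w x + ∑ i, d i * x i ^ 2 := by
  cases isEmpty_or_nonempty ι
  · simp [dirichletEnergy]
  set a : ℝ := (∑ i, x i) / Fintype.card ι
  set y : ι → ℝ := fun i => x i - a
  have hxy (i : ι) : x i = y i + a := (sub_add_cancel _ _).symm
  have hy : ∑ i, y i = 0 := by simp [y, a, mul_div_cancel₀]
  have hx := funext hxy
  have henergy : dirichletEnergy w x = dirichletEnergy w y := by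
    rw [hx, dirichletEnergy_add_const]
  have hpotential : a ^ 2 * ((1 - 2 * K / m) * ∑ i, d i) - m / 2 * ∑ i, y i ^ 2 ≤
      ∑ i, d i * x i ^ 2 := by
    simp only [Finset.mul_sum, ← Finset.sum_sub_distrib]
    gcongr with i
    have hsquare : m / 2 * (y i + 2 * a * d i / m) ^ 2 =
        m / 2 * y i ^ 2 + 2 * a * d i * y i + a ^ 2 * (2 * d i / m * d i) := by
      field_simp
      ring
    have hK : a ^ 2 * (2 * d i / m * d i) ≤ a ^ 2 * (2 * K / m * d i) := by
      gcongr
      exacts [hd i, hdK i]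
    rw [hxy i]
    nlinarith [mul_nonneg (hd i) (sq_nonneg (y i)),
      mul_nonneg hm.le (sq_nonneg (y i + 2 * a * d i / m))]
  rw [sum_sq_eq_card_mul_sq_add x hxy hy, henergy]
  have hsum : 0 ≤ ∑ i, y i ^ 2 := Finset.sum_nonneg fun i _ => sq_nonneg _
  linarith [hgap y hy, mul_le_mul_of_nonneg_left hκd (sq_nonneg a),
    mul_le_mul_of_nonneg_right hκm hsum]

end Potential

section Grounded

open Matrix

theorem le_iff_forall_mul_dotProduct_le {n : Type*} [Fintype n] [DecidableEq n]
    {A : Matrix n n ℝ} (hA : A.IsHermitian) {l : ℝ}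
    (hl : IsLeast {μ | Module.End.HasEigenvalue (toLin' A) μ} l) {κ : ℝ} :
    κ ≤ l ↔ ∀ x : n → ℝ, κ * (x ⬝ᵥ x) ≤ x ⬝ᵥ (A *ᵥ x) := by
  have hherm : (A - algebraMap ℝ _ κ).IsHermitian := by
    rw [algebraMap_eq_diagonal]
    exact hA.sub (isHermitian_diagonal _)
  have hpsd : (A - algebraMap ℝ _ κ).PosSemidef ↔ κ ≤ l := by
    rw [posSemidef_iff_isHermitian_and_spectrum_nonneg, and_iff_right hherm,
      ← spectrum.sub_singleton_eq, Set.sub_singleton, Set.image_subset_iff, ← spectrum_toLin',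
      le_isGLB_iff hl.isGLB]
    simp only [mem_lowerBounds, ← Module.End.hasEigenvalue_iff_mem_spectrum, Set.subset_def,
      Set.mem_preimage, Set.mem_ofPred_eq, sub_nonneg]
  rw [← hpsd, posSemidef_iff_dotProduct_mulVec, and_iff_right hherm]
  simp only [star_trivial, sub_mulVec, dotProduct_sub, Algebra.algebraMap_eq_smul_one, smul_mulVec,
    one_mulVec, dotProduct_smul, smul_eq_mul, sub_nonneg]

variable {V : Type*}

open Classical in
/-- The number of edges of `G` between `A` and `B`, as a real number. Decidability is classical so
that this is a function of the graph alone. -/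
def edgeCount (G : SimpleGraph V) (A B : Finset V) : ℝ :=
  #(G.interedges A B)

theorem edgeCount_nonneg (G : SimpleGraph V) (A B : Finset V) : 0 ≤ edgeCount G A B :=
  Nat.cast_nonneg _

theorem edgeCount_le (G : SimpleGraph V) (A B : Finset V) : edgeCount G A B ≤ #A * #B := by
  classical
  rw [edgeCount]
  exact_mod_cast G.card_interedges_le_mul A B

theorem edgeCount_comm (G : SimpleGraph V) (A B : Finset V) :
    edgeCount G A B = edgeCount G B A := by
  classical
  have : Std.Symm G.Adj := ⟨fun _ _ h => h.symm⟩
  exact congrArg Nat.cast (Rel.card_interedges_comm A B)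

open Classical in
theorem edgeCount_eq_sum (G : SimpleGraph V) (A B : Finset V) :
    edgeCount G A B = ∑ u ∈ A, ∑ v ∈ B, if G.Adj u v then 1 else 0 := by
  rw [edgeCount, SimpleGraph.interedges_def, Finset.card_filter, Finset.sum_product]
  push_cast
  rfl

open Classical in
/-- The edge weights, `0` or `1`, of the subgraph of `G` induced on the nodes that are not
grounded. -/
def groundedWeight (G : SimpleGraph V) (S : Finset V) (u v : {v // v ∉ S}) : ℝ :=
  if G.Adj u v then 1 else 0

variable {G : SimpleGraph V} {S : Finset V}

theorem groundedWeight_nonneg (u v : {v // v ∉ S}) : 0 ≤ groundedWeight G S u v := by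
  unfold groundedWeight
  positivity

theorem groundedWeight_comm (u v : {v // v ∉ S}) :
    groundedWeight G S u v = groundedWeight G S v u := by
  classical
  exact if_congr (G.adj_comm u v) rfl rfl

theorem sum_groundedWeight_eq_edgeCount (A B : Finset {v // v ∉ S}) :
    ∑ u ∈ A, ∑ v ∈ B, groundedWeight G S u v =
      edgeCount G (A.map (.subtype _)) (B.map (.subtype _)) := by
  rw [edgeCount_eq_sum, Finset.sum_map]
  simp only [Finset.sum_map]
  rfl

variable [Fintype V] [DecidableEq V]

theorem sum_subtype_notMem (S : Finset V) (f : V → ℝ) :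
    ∑ v : {v // v ∉ S}, f v = ∑ v ∈ Sᶜ, f v :=
  (Finset.sum_subtype Sᶜ (fun _ => Finset.mem_compl) f).symm

theorem groundedLaplacian_mulVec_apply (x : {v // v ∉ S} → ℝ) (u : {v // v ∉ S}) :
    (groundedLaplacian G S *ᵥ x) u =
      ∑ v, groundedWeight G S u v * (x u - x v) + edgeCount G {u.1} S * x u := by
  classical
  have hdegree : (G.degree u.1 : ℝ) = ∑ v, groundedWeight G S u v + edgeCount G {u.1} S := by
    rw [G.degree_eq_sum_if_adj (R := ℝ), edgeCount_eq_sum, Finset.sum_singleton,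
      ← Finset.sum_compl_add_sum S, ← sum_subtype_notMem]
    rfl
  have hentry (v : {v // v ∉ S}) : groundedLaplacian G S u v =
      (if u = v then (G.degree u.1 : ℝ) else 0) - groundedWeight G S u v := by
    simp [groundedLaplacian, SimpleGraph.lapMatrix, SimpleGraph.degMatrix, diagonal_apply,
      groundedWeight, Subtype.ext_iff]
  simp only [mulVec, dotProduct, hentry, sub_mul, ite_mul, zero_mul, Finset.sum_sub_distrib,
    Finset.sum_ite_eq, Finset.mem_univ, if_true, hdegree, mul_sub, ← Finset.sum_mul]
  ring

theorem dotProduct_groundedLaplacian_mulVec (x : {v // v ∉ S} → ℝ) :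
    x ⬝ᵥ (groundedLaplacian G S *ᵥ x) =
      dirichletEnergy (groundedWeight G S) x + ∑ v, edgeCount G {v.1} S * x v ^ 2 := by
  rw [dirichletEnergy_eq_sum_mul_sum groundedWeight_comm, ← Finset.sum_add_distrib]
  refine Finset.sum_congr rfl fun u _ => ?_
  rw [groundedLaplacian_mulVec_apply]
  ring

theorem sum_edgeCount_singleton (G : SimpleGraph V) (S : Finset V) :
    ∑ v : {v // v ∉ S}, edgeCount G {v.1} S = edgeCount G S Sᶜ := by
  rw [sum_subtype_notMem S fun v => edgeCount G {v} S, edgeCount_comm G S]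
  simp only [edgeCount_eq_sum, Finset.sum_singleton]

theorem le_groundedEigenvalue_iff (hS : ∃ v, v ∉ S) {κ : ℝ} :
    κ ≤ groundedEigenvalue G S ↔ ∀ x : {v // v ∉ S} → ℝ, κ * ∑ v, x v ^ 2 ≤
      dirichletEnergy (groundedWeight G S) x + ∑ v, edgeCount G {v.1} S * x v ^ 2 := by
  rw [le_iff_forall_mul_dotProduct_le (isHermitian_groundedLaplacian G S)
    (isLeast_groundedEigenvalue G S hS)]
  simp only [dotProduct_groundedLaplacian_mulVec]
  simp only [dotProduct, sq]

theorem card_subtype_notMem (S : Finset V) : Fintype.card {v // v ∉ S} = #Sᶜ :=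
  Fintype.card_of_subtype Sᶜ fun _ => Finset.mem_compl

/-- Test the quadratic form with the all-ones vector. -/
theorem groundedEigenvalue_mul_card_compl_le (hS : ∃ v, v ∉ S) :
    groundedEigenvalue G S * #Sᶜ ≤ edgeCount G S Sᶜ := by
  have hones := (le_groundedEigenvalue_iff (G := G) hS).1 le_rfl fun _ => 1
  have henergy : dirichletEnergy (groundedWeight G S) (fun _ => 1) = 0 := by simp [dirichletEnergy]
  simpa only [henergy, zero_add, one_pow, mul_one, Finset.sum_const, nsmul_eq_mul,
    Finset.card_univ, sum_edgeCount_singleton, card_subtype_notMem] using hones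

theorem groundedEigenvalue_mem_Icc {β D m δ p : ℝ} (hS : ∃ v, v ∉ S) (hm : m = β ^ 2 / (8 * D))
    (hβ : 0 < β) (hD : 0 < D) (hexp : IsEdgeExpanding (groundedWeight G S) β)
    (hdeg : ∀ u, ∑ v, groundedWeight G S u v ≤ D) (hSm : 2 * #S ≤ m) (hp : p ∈ Set.Icc 0 1)
    (hδ : 0 ≤ δ) (hbdry : edgeCount G S Sᶜ ∈
      Set.Icc ((1 - δ) * (#S * #Sᶜ * p)) ((1 + δ) * (#S * #Sᶜ * p))) :
    groundedEigenvalue G S ∈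
      Set.Icc ((1 - (δ + 2 * #S / m)) * (#S * p)) ((1 + δ) * (#S * p)) := by
  have hm0 : 0 < m := hm ▸ by positivity
  have hcompl : (0 : ℝ) < #Sᶜ := by
    obtain ⟨v, hv⟩ := hS
    exact Nat.cast_pos.2 (Finset.card_pos.2 ⟨v, Finset.mem_compl.2 hv⟩)
  have hratio : 0 ≤ 1 - 2 * #S / m := sub_nonneg.2 ((div_le_one hm0).2 hSm)
  have hSp : 0 ≤ #S * p := mul_nonneg (Nat.cast_nonneg _) hp.1
  constructor
  · rw [le_groundedEigenvalue_iff hS]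
    refine mul_sum_sq_le_dirichletEnergy_add (K := #S) hm0
      (fun y hy => hm ▸ hexp.cheeger groundedWeight_nonneg groundedWeight_comm hβ.le hD hdeg hy)
      (fun v => edgeCount_nonneg _ _ _) (fun v => ?_) ?_ ?_
    · simpa using edgeCount_le G {v.1} S
    · have hle : 1 - (δ + 2 * #S / m) ≤ 1 := by
        have : 0 ≤ 2 * #S / m := by positivity
        linarith
      calc (1 - (δ + 2 * #S / m)) * (#S * p) ≤ #S * p := mul_le_of_le_one_left hSp hle
        _ ≤ #S := mul_le_of_le_one_right (Nat.cast_nonneg _) hp.2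
        _ ≤ m / 2 := by linarith
    · rw [sum_edgeCount_singleton, card_subtype_notMem]
      calc (1 - (δ + 2 * #S / m)) * (#S * p) * #Sᶜ
          ≤ (1 - 2 * #S / m) * ((1 - δ) * (#S * #Sᶜ * p)) := by
            have : 0 ≤ δ * (2 * #S / m) * (#S * p * #Sᶜ) := by positivity
            linarith
        _ ≤ (1 - 2 * #S / m) * edgeCount G S Sᶜ := by
            gcongr
            exact hbdry.1
  · refine le_of_mul_le_mul_right ?_ hcompl
    calc groundedEigenvalue G S * #Sᶜ ≤ edgeCount G S Sᶜ :=
          groundedEigenvalue_mul_card_compl_le hS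
      _ ≤ (1 + δ) * (#S * #Sᶜ * p) := hbdry.2
      _ = (1 + δ) * (#S * p) * #Sᶜ := by ring

end Grounded

section Chernoff

open unitInterval
open scoped ProbabilityTheory

theorem measurable_edgeCount {V : Type*} (A B : Finset V) :
    Measurable fun G : SimpleGraph V => edgeCount G A B := by
  classical
  simp only [edgeCount_eq_sum]
  have hindicator : Measurable fun q : Prop => if q then (1 : ℝ) else 0 := measurable_from_top
  refine Finset.measurable_sum _ fun u _ => Finset.measurable_sum _ fun v _ => ?_
  exact hindicator.comp (by fun_prop : Measurable fun G : SimpleGraph V => G.Adj u v)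

open Classical in
theorem mgf_sum_ite_mem_setBernoulli {ι : Type*} {u : Set ι} (p : I) {E : Finset ι}
    (hE : (E : Set ι) ⊆ u) (t : ℝ) :
    mgf (fun s : Set ι => ∑ e ∈ E, if e ∈ s then (1 : ℝ) else 0) setBer(u, p) t =
      (1 + p * (Real.exp t - 1)) ^ #E := by
  set f : Prop → ℝ := fun q => if q then 1 else 0
  have hf : Measurable f := measurable_from_top
  have hcoord (e : ι) (he : e ∈ E) :
      mgf (fun q : ι → Prop => f (q e))
        (Measure.infinitePi fun i => bernoulliMeasure (i ∈ u) False p) t =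
        1 + p * (Real.exp t - 1) := by
    have heval : Measurable (Function.eval e : (ι → Prop) → Prop) := measurable_pi_apply e
    change mgf (f ∘ Function.eval (β := fun _ : ι => Prop) e) _ t = _
    rw [← mgf_map heval.aemeasurable (hf.const_mul t).exp.aestronglyMeasurable,
      Measure.infinitePi_map_eval, mgf, integral_bernoulliMeasure]
    simp only [f, hE he, if_true, if_false, mul_one, mul_zero, Real.exp_zero, smul_eq_mul]
    ring
  have hindep := iIndepFun_infinitePi (X := fun (_ : ι) => f)
    (P := fun i => bernoulliMeasure (i ∈ u) False p) fun _ => hf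
  have hsum : Measurable fun s : Set ι => ∑ e ∈ E, if e ∈ s then (1 : ℝ) else 0 :=
    Finset.measurable_sum _ fun e _ => hf.comp (measurable_set_mem e)
  rw [setBernoulli_eq_map,
    mgf_map (by fun_prop) (hsum.const_mul t).exp.aestronglyMeasurable, ← Finset.prod_const,
    ← Finset.prod_congr rfl hcoord]
  exact (congrArg (mgf · _ t) (by ext q; simp [f])).trans (hindep.mgf_sum (by fun_prop) E)

variable {V : Type*} [Countable V]

instance : MeasurableSingletonClass (SimpleGraph V) where
  measurableSet_singleton G := by
    rw [← SimpleGraph.measurableEmbedding_edgeSet.measurableSet_image, Set.image_singleton]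
    exact measurableSet_singleton _

variable (p : I) {A B : Finset V}

theorem mgf_edgeCount_binomialRandom (hAB : Disjoint A B) (t : ℝ) :
    mgf (edgeCount · A B) (SimpleGraph.binomialRandom V p) t =
      (1 + p * (Real.exp t - 1)) ^ (#A * #B) := by
  classical
  have hne {x : V × V} (hx : x ∈ A ×ˢ B) : x.1 ≠ x.2 :=
    hAB.forall_ne_finset (Finset.mem_product.1 hx).1 (Finset.mem_product.1 hx).2
  have hinj : Set.InjOn (fun x : V × V => s(x.1, x.2)) (A ×ˢ B : Finset (V × V)) := by
    intro x hx y hy hxy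
    rcases Sym2.eq_iff.1 hxy with h | h
    · exact Prod.ext h.1 h.2
    · exact absurd h.1 (hAB.forall_ne_finset (Finset.mem_product.1 hx).1
        (Finset.mem_product.1 hy).2)
  set E := (A ×ˢ B).image fun x : V × V => s(x.1, x.2)
  have hE : (E : Set (Sym2 V)) ⊆ Sym2.diagSetᶜ := by
    intro e he
    obtain ⟨x, hx, rfl⟩ := Finset.mem_image.1 (Finset.mem_coe.1 he)
    simpa using hne hx
  have hcount (s : Set (Sym2 V)) : edgeCount (.fromEdgeSet s) A B =
      ∑ e ∈ E, if e ∈ s then (1 : ℝ) else 0 := by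
    rw [edgeCount_eq_sum, Finset.sum_image hinj, ← Finset.sum_product']
    refine Finset.sum_congr rfl fun x hx => ?_
    simp only [SimpleGraph.fromEdgeSet_adj, hne hx, ne_eq, not_false_eq_true, and_true]
  rw [SimpleGraph.binomialRandom_eq_map,
    mgf_map (by fun_prop) ((measurable_edgeCount A B).const_mul t).exp.aestronglyMeasurable]
  simp only [Function.comp_def, hcount]
  rw [mgf_sum_ite_mem_setBernoulli p hE, Finset.card_image_of_injOn hinj, Finset.card_product]

theorem mgf_edgeCount_binomialRandom_pos (hAB : Disjoint A B) (t : ℝ) :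
    0 < mgf (edgeCount · A B) (SimpleGraph.binomialRandom V p) t := by
  rw [mgf_edgeCount_binomialRandom p hAB]
  have hbase : 1 + p * (Real.exp t - 1) = σ p * 1 + p * Real.exp t := by
    rw [coe_symm_eq]
    ring
  refine pow_pos ?_ _
  rcases p.2.1.eq_or_lt with hp | hp
  · simp [← hp]
  · rw [hbase]
    exact add_pos_of_nonneg_of_pos (mul_nonneg (σ p).2.1 zero_le_one) (by positivity)

theorem mgf_edgeCount_binomialRandom_le (hAB : Disjoint A B) (t : ℝ) :
    mgf (edgeCount · A B) (SimpleGraph.binomialRandom V p) t ≤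
      Real.exp (#A * #B * p * (Real.exp t - 1)) := by
  have hbase : 0 ≤ 1 + p * (Real.exp t - 1) := by
    nlinarith [p.2.2, mul_nonneg p.2.1 (Real.exp_pos t).le]
  calc mgf (edgeCount · A B) (SimpleGraph.binomialRandom V p) t
      = (p * (Real.exp t - 1) + 1) ^ (#A * #B) := by
        rw [mgf_edgeCount_binomialRandom p hAB, add_comm]
    _ ≤ Real.exp (p * (Real.exp t - 1)) ^ (#A * #B) := by
        gcongr
        · linarith
        · exact Real.add_one_le_exp _
    _ = Real.exp (#A * #B * p * (Real.exp t - 1)) := by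
        rw [← Real.exp_nat_mul, Nat.cast_mul, mul_assoc (_ * _)]

theorem binomialRandom_real_le_edgeCount_le (hAB : Disjoint A B) {t : ℝ} (ht : 0 ≤ t) (a : ℝ) :
    (SimpleGraph.binomialRandom V p).real {G | a ≤ edgeCount G A B} ≤
      Real.exp (#A * #B * p * (Real.exp t - 1) - t * a) := by
  refine (measure_ge_le_exp_mul_mgf a ht
    (mgf_pos_iff.1 (mgf_edgeCount_binomialRandom_pos p hAB t))).trans ?_
  rw [sub_eq_neg_add, Real.exp_add, neg_mul]
  gcongr
  exact mgf_edgeCount_binomialRandom_le p hAB t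

theorem binomialRandom_real_edgeCount_le_le (hAB : Disjoint A B) {t : ℝ} (ht : t ≤ 0) (a : ℝ) :
    (SimpleGraph.binomialRandom V p).real {G | edgeCount G A B ≤ a} ≤
      Real.exp (#A * #B * p * (Real.exp t - 1) - t * a) := by
  refine (measure_le_le_exp_mul_mgf a ht
    (mgf_pos_iff.1 (mgf_edgeCount_binomialRandom_pos p hAB t))).trans ?_
  rw [sub_eq_neg_add, Real.exp_add, neg_mul]
  gcongr
  exact mgf_edgeCount_binomialRandom_le p hAB t

end Chernoff

section Concentration

open unitInterval

theorem exp_sub_one_le_add_sq {t : ℝ} (ht : |t| ≤ 1) : Real.exp t - 1 ≤ t + t ^ 2 := by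
  linarith [(abs_le.1 (Real.abs_exp_sub_one_sub_id_le ht)).2]

theorem binomialRandom_real_edgeCount_notMem_Icc_le {V : Type*} [Countable V] (p : I)
    {A B : Finset V} (hAB : Disjoint A B) {δ : ℝ} (hδ : δ ∈ Set.Icc 0 1) :
    (SimpleGraph.binomialRandom V p).real {G | edgeCount G A B ∉
      Set.Icc ((1 - δ) * (#A * #B * p)) ((1 + δ) * (#A * #B * p))} ≤
      2 * Real.exp (-(#A * #B * p * δ ^ 2 / 4)) := by
  obtain ⟨hδ0, hδ1⟩ := hδ
  set M : ℝ := #A * #B * p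
  have hM : 0 ≤ M := mul_nonneg (by positivity) p.2.1
  have hlower : (SimpleGraph.binomialRandom V p).real {G | edgeCount G A B ≤ (1 - δ) * M} ≤
      Real.exp (-(M * δ ^ 2 / 4)) := by
    refine (binomialRandom_real_edgeCount_le_le p hAB (t := -(δ / 2)) (by linarith) _).trans ?_
    have := mul_le_mul_of_nonneg_left (exp_sub_one_le_add_sq (t := -(δ / 2))
      (abs_le.2 ⟨by linarith, by linarith⟩)) hM
    exact Real.exp_le_exp.2 (by linarith)
  have hupper : (SimpleGraph.binomialRandom V p).real {G | (1 + δ) * M ≤ edgeCount G A B} ≤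
      Real.exp (-(M * δ ^ 2 / 4)) := by
    refine (binomialRandom_real_le_edgeCount_le p hAB (t := δ / 2) (by linarith) _).trans ?_
    have := mul_le_mul_of_nonneg_left (exp_sub_one_le_add_sq (t := δ / 2)
      (abs_le.2 ⟨by linarith, by linarith⟩)) hM
    exact Real.exp_le_exp.2 (by linarith)
  have hcover : {G | edgeCount G A B ∉ Set.Icc ((1 - δ) * M) ((1 + δ) * M)} ⊆
      {G | edgeCount G A B ≤ (1 - δ) * M} ∪ {G | (1 + δ) * M ≤ edgeCount G A B} := by
    intro G hG
    by_contra h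
    obtain ⟨h1, h2⟩ := not_or.1 h
    exact hG ⟨(not_le.1 h1).le, (not_le.1 h2).le⟩
  calc _ ≤ _ := measureReal_mono hcover
    _ ≤ _ := measureReal_union_le _ _
    _ ≤ _ := by linarith

/-- The constant `c` for which a random graph of mean degree `L` with `log n ≤ (1 - τ) L` is
`c L`-edge-expanding with high probability. It is the solution of `t c = τ / 16`, where
`t = log (8 / τ)` is the Chernoff parameter that makes `exp (-t) = τ / 8`. -/
def expansionRate (τ : ℝ) : ℝ :=
  τ / (16 * Real.log (8 / τ))

theorem one_le_log_eight_div {τ : ℝ} (hτ : τ ∈ Set.Ioc 0 1) : 1 ≤ Real.log (8 / τ) := by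
  obtain ⟨hτ0, hτ1⟩ := hτ
  rw [Real.le_log_iff_exp_le (by positivity), le_div_iff₀ hτ0]
  nlinarith [Real.exp_one_lt_d9, Real.exp_pos 1]

theorem expansionRate_pos {τ : ℝ} (hτ : τ ∈ Set.Ioc 0 1) : 0 < expansionRate τ :=
  div_pos hτ.1 (by linarith [one_le_log_eight_div hτ])

theorem expansionRate_le {τ : ℝ} (hτ : τ ∈ Set.Ioc 0 1) : expansionRate τ ≤ τ / 16 :=
  div_le_div_of_nonneg_left hτ.1.le (by norm_num) (by linarith [one_le_log_eight_div hτ])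

variable {V : Type*} [Fintype V] (p : I) {τ L : ℝ}

theorem card_le_of_two_mul_card_le (hτ : τ ∈ Set.Ioc 0 1) (hL : L = Fintype.card V * p)
    {S : Finset V} (hSm : 2 * #S ≤ expansionRate τ ^ 2 * L / 32) :
    #S ≤ τ / 16 * Fintype.card V := by
  have hrate : expansionRate τ ^ 2 ≤ τ / 16 := by
    nlinarith [expansionRate_pos hτ, expansionRate_le hτ, hτ.2]
  have hmean : L ≤ Fintype.card V := hL ▸ mul_le_of_le_one_right (Nat.cast_nonneg _) p.2.2
  have hL0 : 0 ≤ L := hL ▸ mul_nonneg (Nat.cast_nonneg _) p.2.1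
  linarith [mul_le_mul hrate hmean hL0 (by linarith [hτ.1])]

theorem binomialRandom_real_edgeCount_le_expansionRate_mul_le (hτ : τ ∈ Set.Ioc 0 1)
    (hL : L = Fintype.card V * p) {A B : Finset V} (hAB : Disjoint A B) {b : ℝ}
    (hB : b * Fintype.card V ≤ #B) :
    (SimpleGraph.binomialRandom V p).real
      {G | edgeCount G A B ≤ expansionRate τ * L * #A} ≤
      Real.exp (-(#A * L * ((1 - τ / 8) * b - τ / 16))) := by
  have hlog := one_le_log_eight_div hτ
  have hexp : Real.exp (-Real.log (8 / τ)) = τ / 8 := by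
    rw [Real.exp_neg, Real.exp_log (div_pos (by norm_num) hτ.1), inv_div]
  have hrate : Real.log (8 / τ) * expansionRate τ = τ / 16 := by
    rw [expansionRate]
    field_simp
  refine (binomialRandom_real_edgeCount_le_le p hAB (neg_nonpos.2 (zero_le_one.trans hlog))
    _).trans (Real.exp_le_exp.2 ?_)
  have hmean : L * b ≤ #B * p := by
    rw [hL, mul_right_comm, mul_comm _ b]
    exact mul_le_mul_of_nonneg_right hB p.2.1
  have hτ8 : 0 ≤ #A * (1 - τ / 8) := mul_nonneg (by positivity) (by linarith [hτ.2])
  calc (#A : ℝ) * #B * p * (Real.exp (-Real.log (8 / τ)) - 1) -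
        -Real.log (8 / τ) * (expansionRate τ * L * #A)
      = -(#A * (1 - τ / 8) * (#B * p)) + #A * L * (Real.log (8 / τ) * expansionRate τ) := by
        rw [hexp]
        ring
    _ ≤ -(#A * (1 - τ / 8) * (L * b)) + #A * L * (Real.log (8 / τ) * expansionRate τ) := by
        gcongr
    _ = -(#A * L * ((1 - τ / 8) * b - τ / 16)) := by
        rw [hrate]
        ring

/-- Sets with at most `τ n / 8` elements produce the first summand, larger ones the second. -/
theorem binomialRandom_real_edgeCount_le_expansionRate_mul_le_add (hτ : τ ∈ Set.Ioc 0 1)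
    (hL : L = Fintype.card V * p) {A B : Finset V} (hAB : Disjoint A B)
    (hcard : (1 - τ / 16) * Fintype.card V ≤ #A + #B) (hle : #A ≤ #B) :
    (SimpleGraph.binomialRandom V p).real
      {G | edgeCount G A B ≤ expansionRate τ * L * #A} ≤
      Real.exp (-((1 - τ / 2) * L)) ^ #A + Real.exp (-(τ * L / 32)) ^ Fintype.card V := by
  have hL0 : 0 ≤ L := hL ▸ mul_nonneg (by positivity) p.2.1
  have hle' : (#A : ℝ) ≤ #B := by exact_mod_cast hle
  have hAL : 0 ≤ #A * L := by positivity
  obtain ⟨hτ0, hτ1⟩ := hτ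
  simp only [← Real.exp_nat_mul]
  rcases le_total (#A : ℝ) (τ / 8 * Fintype.card V) with hsmall | hlarge
  · refine (binomialRandom_real_edgeCount_le_expansionRate_mul_le p ⟨hτ0, hτ1⟩ hL hAB
      (b := 1 - τ / 16 - τ / 8) (by linarith)).trans
      (le_add_of_le_of_nonneg (Real.exp_le_exp.2 ?_) (by positivity))
    have hrate : 1 - τ / 2 ≤ (1 - τ / 8) * (1 - τ / 16 - τ / 8) - τ / 16 := by nlinarith
    linarith [mul_le_mul_of_nonneg_left hrate hAL]
  · refine (binomialRandom_real_edgeCount_le_expansionRate_mul_le p ⟨hτ0, hτ1⟩ hL hAB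
      (b := 15 / 32) (by nlinarith [Nat.cast_nonneg (α := ℝ) (Fintype.card V)])).trans
      (le_add_of_nonneg_of_le (by positivity) (Real.exp_le_exp.2 ?_))
    have hrate : 1 / 4 ≤ (1 - τ / 8) * (15 / 32) - τ / 16 := by linarith
    linarith [mul_le_mul_of_nonneg_left hrate hAL, mul_le_mul_of_nonneg_right hlarge hL0]

theorem sum_erase_empty_pow_card (ι : Type*) [Fintype ι] [DecidableEq ι] (q : ℝ) :
    ∑ A ∈ (Finset.univ : Finset (Finset ι)).erase ∅, q ^ #A = (1 + q) ^ Fintype.card ι - 1 := by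
  rw [Finset.sum_erase_eq_sub (Finset.mem_univ ∅), Finset.card_empty, pow_zero, add_comm 1 q,
    ← Fintype.sum_pow_mul_eq_add_pow ι q 1]
  simp only [one_pow, mul_one]

variable [DecidableEq V] {S : Finset V}

theorem sum_groundedWeight_eq_edgeCount_compl (G : SimpleGraph V) (u : {v // v ∉ S}) :
    ∑ v, groundedWeight G S u v =
      edgeCount G {u.1} (({u}ᶜ : Finset {v // v ∉ S}).map (.subtype _)) := by
  have hself : groundedWeight G S u u = 0 := by simp [groundedWeight]
  rw [Fintype.sum_eq_add_sum_compl u, hself, zero_add]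
  simpa using sum_groundedWeight_eq_edgeCount (G := G) {u} {u}ᶜ

theorem binomialRandom_real_exists_lt_sum_groundedWeight_le (S : Finset V)
    (hL : L = Fintype.card V * p) :
    (SimpleGraph.binomialRandom V p).real {G | ∃ u, 4 * L < ∑ v, groundedWeight G S u v} ≤
      Fintype.card V * Real.exp (-(2 * L)) := by
  have hdegree (u : {v // v ∉ S}) : (SimpleGraph.binomialRandom V p).real
      {G | 4 * L < ∑ v, groundedWeight G S u v} ≤ Real.exp (-(2 * L)) := by
    simp only [sum_groundedWeight_eq_edgeCount_compl]
    set B := ({u}ᶜ : Finset {v // v ∉ S}).map (.subtype _)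
    have hdisj : Disjoint {u.1} B := by simp [B]
    refine (measureReal_mono (Set.ofPred_subset_ofPred_of_imp fun _ => le_of_lt)).trans
      ((binomialRandom_real_le_edgeCount_le p hdisj zero_le_one (4 * L)).trans
        (Real.exp_le_exp.2 ?_))
    have hmean : #B * (p : ℝ) ≤ L := by
      rw [hL]
      exact mul_le_mul_of_nonneg_right (Nat.cast_le.2 (Finset.card_le_univ B)) p.2.1
    have hmean0 : 0 ≤ #B * (p : ℝ) := mul_nonneg (Nat.cast_nonneg _) p.2.1
    rw [Finset.card_singleton, Nat.cast_one, one_mul, one_mul]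
    nlinarith [Real.exp_one_lt_d9]
  have hcard : (Fintype.card {v // v ∉ S} : ℝ) ≤ Fintype.card V :=
    Nat.cast_le.2 (Fintype.card_subtype_le _)
  rw [Set.ofPred_exists]
  calc _ ≤ ∑ u : {v // v ∉ S}, (SimpleGraph.binomialRandom V p).real
        {G | 4 * L < ∑ v, groundedWeight G S u v} := measureReal_iUnion_fintype_le _
    _ ≤ ∑ _u : {v // v ∉ S}, Real.exp (-(2 * L)) := Finset.sum_le_sum fun u _ => hdegree u
    _ = Fintype.card {v // v ∉ S} * Real.exp (-(2 * L)) := by simp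
    _ ≤ Fintype.card V * Real.exp (-(2 * L)) := by gcongr

theorem binomialRandom_real_sum_groundedWeight_lt_le (hτ : τ ∈ Set.Ioc 0 1)
    (hL : L = Fintype.card V * p) (hS : #S ≤ τ / 16 * Fintype.card V) {A : Finset {v // v ∉ S}}
    (hA : 2 * #A ≤ Fintype.card {v // v ∉ S}) :
    (SimpleGraph.binomialRandom V p).real
      {G | ∑ u ∈ A, ∑ v ∈ Aᶜ, groundedWeight G S u v < expansionRate τ * L * #A} ≤
      Real.exp (-((1 - τ / 2) * L)) ^ #A + Real.exp (-(τ * L / 32)) ^ Fintype.card V := by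
  have hsplit := Finset.card_add_card_compl A
  have hcard : (1 - τ / 16) * Fintype.card V ≤ (#A : ℝ) + #Aᶜ := by
    rw [← Nat.cast_add, hsplit, card_subtype_notMem, Finset.card_compl,
      Nat.cast_sub (Finset.card_le_univ S)]
    linarith
  have htail := binomialRandom_real_edgeCount_le_expansionRate_mul_le_add p hτ hL
    (A := A.map (.subtype _)) (B := Aᶜ.map (.subtype _))
    ((Finset.disjoint_map _).2 disjoint_compl_right)
    (by simpa only [Finset.card_map] using hcard) (by simp only [Finset.card_map]; omega)
  simp only [← sum_groundedWeight_eq_edgeCount, Finset.card_map] at htail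
  exact (measureReal_mono (Set.ofPred_subset_ofPred_of_imp fun _ => le_of_lt)).trans htail

theorem binomialRandom_real_not_isEdgeExpanding_le (hτ : τ ∈ Set.Ioc 0 1)
    (hL : L = Fintype.card V * p) (hS : #S ≤ τ / 16 * Fintype.card V) :
    (SimpleGraph.binomialRandom V p).real
      {G | ¬ IsEdgeExpanding (groundedWeight G S) (expansionRate τ * L)} ≤
      (1 + Real.exp (-((1 - τ / 2) * L))) ^ Fintype.card V - 1 +
        (2 * Real.exp (-(τ * L / 32))) ^ Fintype.card V := by
  set n := Fintype.card V
  set q := Real.exp (-((1 - τ / 2) * L))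
  set r := Real.exp (-(τ * L / 32))
  set W := {v // v ∉ S}
  have hcardW : Fintype.card W ≤ n := Fintype.card_subtype_le _
  let bad (A : Finset W) : Set (SimpleGraph V) :=
    {G | ∑ u ∈ A, ∑ v ∈ Aᶜ, groundedWeight G S u v < expansionRate τ * L * #A}
  set T := {A ∈ (Finset.univ : Finset (Finset W)).erase ∅ | 2 * #A ≤ Fintype.card W}
  have hcover : {G | ¬ IsEdgeExpanding (groundedWeight G S) (expansionRate τ * L)} ⊆
      ⋃ A ∈ T, bad A := by
    intro G hG
    simp only [IsEdgeExpanding, Set.mem_ofPred_eq, not_forall, not_le] at hG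
    obtain ⟨A, hA, hlt⟩ := hG
    have hne : A ≠ ∅ := by
      rintro rfl
      simp at hlt
    exact Set.mem_biUnion (x := A) (Finset.mem_filter.2 ⟨by simpa using hne, hA⟩) hlt
  calc _ ≤ _ := measureReal_mono hcover (measure_ne_top _ _)
    _ ≤ ∑ A ∈ T, (SimpleGraph.binomialRandom V p).real (bad A) := measureReal_biUnion_finset_le _ _
    _ ≤ ∑ A ∈ T, (q ^ #A + r ^ n) := Finset.sum_le_sum fun A hA =>
        binomialRandom_real_sum_groundedWeight_lt_le p hτ hL hS (Finset.mem_filter.1 hA).2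
    _ ≤ ∑ A ∈ (Finset.univ : Finset (Finset W)).erase ∅, (q ^ #A + r ^ n) :=
        Finset.sum_le_sum_of_subset_of_nonneg (Finset.filter_subset _ _) fun _ _ _ => by positivity
    _ ≤ ((1 + q) ^ Fintype.card W - 1) + 2 ^ Fintype.card W * r ^ n := by
        rw [Finset.sum_add_distrib, sum_erase_empty_pow_card, Finset.sum_const, nsmul_eq_mul]
        gcongr
        exact_mod_cast (Finset.card_le_univ _).trans (Fintype.card_finset (α := W)).le
    _ ≤ (1 + q) ^ n - 1 + (2 * r) ^ n := by
        rw [mul_pow]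
        gcongr
        · exact le_add_of_nonneg_right (Real.exp_pos _).le
        · exact one_le_two

theorem binomialRandom_real_edgeCount_compl_notMem_Icc_le (hL : L = Fintype.card V * p)
    (hS : 2 * #S ≤ Fintype.card V) {δ : ℝ} (hδ : δ ∈ Set.Icc 0 1) :
    (SimpleGraph.binomialRandom V p).real {G | edgeCount G S Sᶜ ∉
      Set.Icc ((1 - δ) * (#S * #Sᶜ * p)) ((1 + δ) * (#S * #Sᶜ * p))} ≤
      2 * Real.exp (-(L * δ ^ 2 / 8)) := by
  rcases S.eq_empty_or_nonempty with rfl | hne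
  · have hzero (G : SimpleGraph V) (B : Finset V) : edgeCount G ∅ B = 0 := by simp [edgeCount]
    simp [hzero, Real.exp_nonneg]
  have hcard : (Fintype.card V : ℝ) ≤ 2 * (#S * #Sᶜ) := by
    have hcompl := Finset.card_add_card_compl S
    exact_mod_cast (by nlinarith [hne.card_pos] : Fintype.card V ≤ 2 * (#S * #Sᶜ))
  have hmean : L ≤ 2 * (#S * #Sᶜ * p) := by
    rw [hL, ← mul_assoc]
    exact mul_le_mul_of_nonneg_right hcard p.2.1
  refine (binomialRandom_real_edgeCount_notMem_Icc_le p disjoint_compl_right hδ).trans ?_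
  have := mul_le_mul_of_nonneg_right hmean (sq_nonneg δ)
  gcongr 2 * Real.exp (-?_)
  linarith

theorem natCast_mul_exp_neg_two_mul_le {n : ℕ} (hn : n ≠ 0) (hlog : Real.log n ≤ L) :
    n * Real.exp (-(2 * L)) ≤ Real.exp (-L) := by
  nth_rewrite 1 [← Real.exp_log (Nat.cast_pos.2 (Nat.pos_of_ne_zero hn))]
  rw [← Real.exp_add, Real.exp_le_exp]
  linarith

theorem one_add_exp_pow_le {n : ℕ} (hn : n ≠ 0) (hlog : Real.log n ≤ (1 - τ) * L) :
    (1 + Real.exp (-((1 - τ / 2) * L))) ^ n ≤ Real.exp (Real.exp (-(τ * L / 2))) := by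
  have hn0 : (0 : ℝ) < n := Nat.cast_pos.2 (Nat.pos_of_ne_zero hn)
  calc (1 + Real.exp (-((1 - τ / 2) * L))) ^ n
      ≤ Real.exp (Real.exp (-((1 - τ / 2) * L))) ^ n := by
        gcongr
        linarith [Real.add_one_le_exp (Real.exp (-((1 - τ / 2) * L)))]
    _ = Real.exp (Real.exp (Real.log n + -((1 - τ / 2) * L))) := by
        rw [← Real.exp_nat_mul, Real.exp_add, Real.exp_log hn0]
    _ ≤ Real.exp (Real.exp (-(τ * L / 2))) := by
        gcongr
        linarith

theorem binomialRandom_real_not_isEdgeExpanding_le_of_log_le (hτ : τ ∈ Set.Ioc 0 1)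
    (hL : L = Fintype.card V * p) (hV : Fintype.card V ≠ 0)
    (hlog : Real.log (Fintype.card V) ≤ (1 - τ) * L) (hS : #S ≤ τ / 16 * Fintype.card V) :
    (SimpleGraph.binomialRandom V p).real
      {G | ¬ IsEdgeExpanding (groundedWeight G S) (expansionRate τ * L)} ≤
      Real.exp (Real.exp (-(τ * L / 2))) - 1 + 2 * Real.exp (-(τ * L / 32)) := by
  rcases le_total (2 * Real.exp (-(τ * L / 32))) 1 with hle | hge
  · refine (binomialRandom_real_not_isEdgeExpanding_le p hτ hL hS).trans ?_
    gcongr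
    · exact one_add_exp_pow_le hV hlog
    · exact pow_le_of_le_one (by positivity) hle hV
  · refine measureReal_le_one.trans (hge.trans (le_add_of_nonneg_left ?_))
    exact sub_nonneg.2 (Real.one_le_exp (Real.exp_pos _).le)

/-- Bound on the probability that the boundary edge count of the grounded set has relative error
more than `δ`, that some degree exceeds `4 L`, or that edge expansion fails. -/
def failureBound (τ δ L : ℝ) : ℝ :=
  2 * Real.exp (-(L * δ ^ 2 / 8)) + Real.exp (-L) +
    (Real.exp (Real.exp (-(τ * L / 2))) - 1 + 2 * Real.exp (-(τ * L / 32)))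

theorem binomialRandom_real_groundedEigenvalue_notMem_Icc_le (hτ : τ ∈ Set.Ioc 0 1)
    (hL : L = Fintype.card V * p) (hL0 : 0 < L) (hlog : Real.log (Fintype.card V) ≤ (1 - τ) * L)
    {m δ : ℝ} (hm : m = expansionRate τ ^ 2 * L / 32) (hSm : 2 * #S ≤ m) (hδ : δ ∈ Set.Icc 0 1) :
    (SimpleGraph.binomialRandom V p).real {G | groundedEigenvalue G S ∉
      Set.Icc ((1 - (δ + 2 * #S / m)) * (#S * p)) ((1 + δ) * (#S * p))} ≤
      failureBound τ δ L := by
  have hn : (0 : ℝ) < Fintype.card V := pos_of_mul_pos_left (hL ▸ hL0) p.2.1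
  have hS := card_le_of_two_mul_card_le p hτ hL (hm ▸ hSm)
  have hS2 : 2 * #S < Fintype.card V := by
    exact_mod_cast (by nlinarith [hτ.2] : 2 * (#S : ℝ) < Fintype.card V)
  have hcompl : ∃ v, v ∉ S := by
    simpa using Finset.exists_mem_notMem_of_card_lt_card (s := S) (t := Finset.univ)
      (by rw [Finset.card_univ]; omega)
  have hrate := expansionRate_pos hτ
  let boundary : Set (SimpleGraph V) := {G | edgeCount G S Sᶜ ∉
    Set.Icc ((1 - δ) * (#S * #Sᶜ * p)) ((1 + δ) * (#S * #Sᶜ * p))}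
  let degree : Set (SimpleGraph V) := {G | ∃ u, 4 * L < ∑ v, groundedWeight G S u v}
  let expansion : Set (SimpleGraph V) :=
    {G | ¬ IsEdgeExpanding (groundedWeight G S) (expansionRate τ * L)}
  have hcover : {G | groundedEigenvalue G S ∉
      Set.Icc ((1 - (δ + 2 * #S / m)) * (#S * p)) ((1 + δ) * (#S * p))} ⊆
      (boundary ∪ degree) ∪ expansion := by
    intro G hG
    by_contra hgood
    simp only [boundary, degree, expansion, Set.mem_union, Set.mem_ofPred_eq, not_or, not_not,
      not_exists, not_lt] at hgood
    obtain ⟨⟨hbdry, hdeg⟩, hexp⟩ := hgood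
    refine hG (groundedEigenvalue_mem_Icc hcompl ?_ (by positivity) (by positivity) hexp hdeg hSm
      p.2 hδ.1 hbdry)
    rw [hm]
    field_simp
    norm_num
  have hdegree : (SimpleGraph.binomialRandom V p).real degree ≤ Real.exp (-L) :=
    (binomialRandom_real_exists_lt_sum_groundedWeight_le p S hL).trans
      (natCast_mul_exp_neg_two_mul_le (Nat.cast_pos.1 hn).ne' (by linarith [mul_pos hτ.1 hL0]))
  refine (measureReal_mono hcover).trans ((measureReal_union_le _ _).trans (add_le_add
    ((measureReal_union_le _ _).trans (add_le_add ?_ hdegree)) ?_))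
  · exact binomialRandom_real_edgeCount_compl_notMem_Icc_le p hL hS2.le hδ
  · exact binomialRandom_real_not_isEdgeExpanding_le_of_log_le p hτ hL (Nat.cast_pos.1 hn).ne'
      hlog hS

end Concentration

section Asymptotics

open Asymptotics

theorem exists_log_le_of_limsup_lt_one {L : ℕ → ℝ}
    (h : limsup (fun n : ℕ => ENNReal.ofReal (Real.log n) / ENNReal.ofReal (L n)) atTop < 1) :
    ∃ τ ∈ Set.Ioc (0 : ℝ) 1, ∀ᶠ n : ℕ in atTop, 0 < L n ∧ Real.log n ≤ (1 - τ) * L n := by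
  obtain ⟨b, hlimsup, hb⟩ := exists_between h
  lift b to NNReal using (hb.trans ENNReal.one_lt_top).ne
  replace hb : (b : ℝ) < 1 := by exact_mod_cast hb
  refine ⟨1 - b, ⟨by linarith, by linarith [b.2]⟩, ?_⟩
  filter_upwards [eventually_lt_of_limsup_lt hlimsup, eventually_ge_atTop 2] with n hlt hn
  have hlog : 0 < Real.log n := Real.log_pos (by exact_mod_cast hn)
  have hL : 0 < L n := by
    by_contra! hL
    rw [ENNReal.ofReal_of_nonpos hL, ENNReal.div_zero (ENNReal.ofReal_pos.2 hlog).ne'] at hlt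
    exact not_top_lt hlt
  refine ⟨hL, ?_⟩
  rw [ENNReal.div_lt_iff (.inl (ENNReal.ofReal_pos.2 hL).ne') (.inl ENNReal.ofReal_ne_top),
    ← ENNReal.ofReal_coe_nnreal, ← ENNReal.ofReal_mul b.coe_nonneg,
    ENNReal.ofReal_lt_ofReal_iff_of_nonneg hlog.le] at hlt
  rw [sub_sub_cancel]
  exact hlt.le

theorem tendsto_atTop_of_limsup_log_div_lt_one {L : ℕ → ℝ}
    (h : limsup (fun n : ℕ => ENNReal.ofReal (Real.log n) / ENNReal.ofReal (L n)) atTop < 1) :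
    Tendsto L atTop atTop := by
  obtain ⟨τ, hτ, hlog⟩ := exists_log_le_of_limsup_lt_one h
  refine tendsto_atTop_mono' _ ?_ (Real.tendsto_log_atTop.comp tendsto_natCast_atTop_atTop)
  filter_upwards [hlog] with n hn
  exact hn.2.trans (mul_le_of_le_one_left hn.1.le (by linarith [hτ.1]))

theorem isLittleO_of_isLittleO_sqrt {ι : Type*} {l : Filter ι} {f L : ι → ℝ}
    (hL : Tendsto L l atTop) (hf : f =o[l] fun i => √(L i)) : f =o[l] L := by
  refine hf.trans_isBigO (.of_bound' ?_)
  filter_upwards [hL.eventually_ge_atTop 1] with i hi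
  rw [Real.norm_of_nonneg (Real.sqrt_nonneg _), Real.norm_of_nonneg (by linarith)]
  exact Real.sqrt_le_self_iff.2 (.inr hi)

theorem tendsto_failureBound {ι : Type*} {l : Filter ι} {τ : ℝ} {δ L : ι → ℝ} (hτ : 0 < τ)
    (hL : Tendsto L l atTop) (hδ : Tendsto (fun i => L i * δ i ^ 2) l atTop) :
    Tendsto (fun i => failureBound τ (δ i) (L i)) l (𝓝 0) := by
  have hexp {f : ι → ℝ} (hf : Tendsto f l atTop) : Tendsto (fun i => Real.exp (-f i)) l (𝓝 0) :=
    Real.tendsto_exp_neg_atTop_nhds_zero.comp hf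
  have hτL : Tendsto (fun i => τ * L i) l atTop := hL.const_mul_atTop hτ
  have hboundary := (hexp (hδ.atTop_div_const (by norm_num : (0 : ℝ) < 8))).const_mul 2
  have hsmall := ((Real.continuous_exp.tendsto 0).comp
    (hexp (hτL.atTop_div_const zero_lt_two))).sub_const 1
  have hlarge := (hexp (hτL.atTop_div_const (by norm_num : (0 : ℝ) < 32))).const_mul 2
  simpa [failureBound] using (hboundary.add (hexp hL)).add (hsmall.add hlarge)

theorem isProbabilityMeasure_groundedErdosRenyi {n k : ℕ} (p : unitInterval) (hk : k ≤ n) :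
    IsProbabilityMeasure (groundedErdosRenyi n p k) := by
  obtain ⟨S, -, hS⟩ := Finset.exists_subset_card_eq (s := (Finset.univ : Finset (Fin n)))
    (n := k) (by simpa using hk)
  have := isProbabilityMeasure_uniformOn (Set.toFinite {S : Finset (Fin n) | #S = k}) ⟨S, hS⟩
  unfold groundedErdosRenyi
  infer_instance

theorem groundedErdosRenyi_compl_le {n k : ℕ} (p : unitInterval)
    {good : Set (SimpleGraph (Fin n) × Finset (Fin n))} {ε : ℝ}
    (h : ∀ S : Finset (Fin n), #S = k →
      (SimpleGraph.binomialRandom (Fin n) p).real {G | (G, S) ∉ good} ≤ ε) :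
    groundedErdosRenyi n p k goodᶜ ≤ ENNReal.ofReal ε := by
  set ν := uniformOn {S : Finset (Fin n) | #S = k}
  have hae : ∀ᵐ S ∂ν,
      SimpleGraph.binomialRandom (Fin n) p ((fun G => (G, S)) ⁻¹' goodᶜ) ≤ ENNReal.ofReal ε := by
    filter_upwards [ae_cond_mem (μ := Measure.count)
      (Set.toFinite {S : Finset (Fin n) | #S = k}).measurableSet] with S hS
    rw [← ofReal_measureReal]
    exact ENNReal.ofReal_le_ofReal (h S hS)
  calc groundedErdosRenyi n p k goodᶜ
      = ∫⁻ S, SimpleGraph.binomialRandom (Fin n) p ((fun G => (G, S)) ⁻¹' goodᶜ) ∂ν :=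
        Measure.prod_apply_symm (Set.toFinite _).measurableSet
    _ ≤ ∫⁻ _, ENNReal.ofReal ε ∂ν := lintegral_mono_ae hae
    _ = ENNReal.ofReal ε * ν Set.univ := lintegral_const _
    _ ≤ ENNReal.ofReal ε := mul_le_of_le_one_right' prob_le_one

theorem tendsto_groundedErdosRenyi_one {p : ℕ → unitInterval} {k : ℕ → ℕ}
    {good : ∀ n, Set (SimpleGraph (Fin n) × Finset (Fin n))} {ε : ℕ → ℝ}
    (hk : ∀ᶠ n in atTop, k n ≤ n) (hε : Tendsto ε atTop (𝓝 0))
    (h : ∀ᶠ n in atTop, ∀ S : Finset (Fin n), #S = k n →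
      (SimpleGraph.binomialRandom (Fin n) (p n)).real {G | (G, S) ∉ good n} ≤ ε n) :
    Tendsto (fun n => groundedErdosRenyi n (p n) (k n) (good n)) atTop (𝓝 1) := by
  have hbad : Tendsto (fun n => groundedErdosRenyi n (p n) (k n) (good n)ᶜ) atTop (𝓝 0) := by
    refine tendsto_of_tendsto_of_tendsto_of_le_of_le' tendsto_const_nhds
      (by simpa using ENNReal.tendsto_ofReal hε) (.of_forall fun _ => zero_le) ?_
    filter_upwards [h] with n hn
    exact groundedErdosRenyi_compl_le (p n) hn
  have hgood := ENNReal.Tendsto.sub (tendsto_const_nhds (x := 1)) hbad (.inl ENNReal.one_ne_top)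
  rw [tsub_zero] at hgood
  refine hgood.congr' ?_
  filter_upwards [hk] with n hn
  have := isProbabilityMeasure_groundedErdosRenyi (p n) hn
  rw [← prob_compl_eq_one_sub (Set.toFinite _).measurableSet, compl_compl]

theorem eventually_le_of_isLittleO_mul {p : ℕ → unitInterval} {k : ℕ → ℕ}
    (hk : (fun n => (k n : ℝ)) =o[atTop] fun n => (n : ℝ) * (p n : ℝ)) :
    ∀ᶠ n in atTop, k n ≤ n := by
  filter_upwards [hk.bound one_pos] with n hn
  have hle : (k n : ℝ) ≤ n * p n := by
    simpa [abs_of_nonneg (p n).2.1] using hn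
  exact_mod_cast hle.trans (mul_le_of_le_one_right n.cast_nonneg (p n).2.2)

end Asymptotics

end

theorem theorem3_general (p : ℕ → unitInterval) (k : ℕ → ℕ)
    (hp : limsup (fun n : ℕ =>
      ENNReal.ofReal (Real.log n) / ENNReal.ofReal ((n : ℝ) * (p n : ℝ))) atTop < 1)
    (hk : (fun n : ℕ => (k n : ℝ)) =o[atTop] fun n : ℕ => (n : ℝ) * (p n : ℝ)) :
    ∃ h ε : ℕ → ℝ, Tendsto h atTop (𝓝 0) ∧ Tendsto ε atTop (𝓝 0) ∧
      ∀ᶠ n in atTop, ∀ S : Finset (Fin n), S.card = k n →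
        (SimpleGraph.binomialRandom (Fin n) (p n)).real {G | groundedEigenvalue G S ∉
          Set.Icc ((1 - h n) * ((k n : ℝ) * (p n : ℝ))) ((1 + h n) * ((k n : ℝ) * (p n : ℝ)))} ≤
          ε n := by
  set L : ℕ → ℝ := fun n => n * p n
  obtain ⟨τ, hτ, hlog⟩ := exists_log_le_of_limsup_lt_one hp
  have hL : Tendsto L atTop atTop := tendsto_atTop_of_limsup_log_div_lt_one hp
  have hsqrt : Tendsto (fun n => √(L n)) atTop atTop := Real.tendsto_sqrt_atTop.comp hL
  let m : ℕ → ℝ := fun n => expansionRate τ ^ 2 * L n / 32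
  let δ : ℕ → ℝ := fun n => (√(√(L n)))⁻¹
  have hδ : Tendsto δ atTop (𝓝 0) :=
    tendsto_inv_atTop_zero.comp (Real.tendsto_sqrt_atTop.comp hsqrt)
  have hδL (n : ℕ) : L n * δ n ^ 2 = √(L n) := by
    rw [inv_pow, Real.sq_sqrt (Real.sqrt_nonneg _), ← div_eq_mul_inv, Real.div_sqrt]
  have hkm : Tendsto (fun n => 2 * k n / m n) atTop (𝓝 0) := by
    have hkL := hk.tendsto_div_nhds_zero.const_mul (64 / expansionRate τ ^ 2)
    rw [mul_zero] at hkL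
    exact hkL.congr fun n => by ring
  refine ⟨fun n => δ n + 2 * k n / m n, fun n => failureBound τ (δ n) (L n),
    by simpa using hδ.add hkm, tendsto_failureBound hτ.1 hL (by simpa only [hδL] using hsqrt), ?_⟩
  filter_upwards [hlog, hδ.eventually_le_const one_pos, hkm.eventually_le_const one_pos]
    with n hn hδ1 hkm1 S hS
  have hrate := expansionRate_pos hτ
  have hm : 0 < m n := div_pos (mul_pos (pow_pos hrate 2) hn.1) (by norm_num)
  have hδ0 : 0 ≤ δ n := by positivity
  have hwiden : Set.Icc ((1 - (δ n + 2 * k n / m n)) * (k n * p n)) ((1 + δ n) * (k n * p n)) ⊆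
      Set.Icc ((1 - (δ n + 2 * k n / m n)) * (k n * p n))
        ((1 + (δ n + 2 * k n / m n)) * (k n * p n)) := by
    have hp0 : (0 : ℝ) ≤ p n := (p n).2.1
    refine Set.Icc_subset_Icc_right ?_
    gcongr
    exact le_add_of_nonneg_right (by positivity)
  have hfixed := binomialRandom_real_groundedEigenvalue_notMem_Icc_le (S := S) (p n) hτ
    (by simp) hn.1 (by simpa using hn.2) rfl (hS ▸ (div_le_one hm).1 hkm1) ⟨hδ0, hδ1⟩
  rw [hS] at hfixed
  exact (measureReal_mono (Set.ofPred_subset_ofPred_of_imp fun _ => mt (@hwiden _))).trans hfixed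

theorem theorem3 (p : ℕ → unitInterval) (k : ℕ → ℕ)
    -- the quotient is taken in `[0, ∞]`, where `ln n / (n p) = ∞` for `p = 0` and `n ≥ 2`
    (hp : limsup (fun n : ℕ =>
      ENNReal.ofReal (Real.log n) / ENNReal.ofReal ((n : ℝ) * (p n : ℝ))) atTop < 1)
    (hk_pos : ∀ᶠ n in atTop, 1 ≤ k n)
    (hk : (fun n : ℕ => (k n : ℝ)) =o[atTop] fun n : ℕ => Real.sqrt ((n : ℝ) * (p n : ℝ))) :
    ∃ h : ℕ → ℝ, Tendsto h atTop (𝓝 0) ∧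
      Tendsto (fun n : ℕ => groundedErdosRenyi n (p n) (k n)
        {x : SimpleGraph (Fin n) × Finset (Fin n) |
          (1 - h n) * ((k n : ℝ) * (p n : ℝ)) ≤ groundedEigenvalue x.1 x.2 ∧
          groundedEigenvalue x.1 x.2 ≤ (1 + h n) * ((k n : ℝ) * (p n : ℝ))})
        atTop (𝓝 1) := by
  have hk' := isLittleO_of_isLittleO_sqrt (tendsto_atTop_of_limsup_log_div_lt_one hp) hk
  obtain ⟨h, ε, hh, hε, hbad⟩ := theorem3_general p k hp hk'
  exact ⟨h, hh, tendsto_groundedErdosRenyi_one (eventually_le_of_isLittleO_mul hk') hε hbad⟩
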